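/- Let $q$ be a prime power and let $n,t,r$ be integers with $n>t$, $2\le r<t\le \Theta_r$ and $r\equiv n \pmod t$, where $\Theta_r=(q^r-1)/(q-1)$. A partial $(t-1)$-spread of the projective space $\mathrm{PG}(n-1,q)$ over the field $\mathbb{F}_q$ is a set of pairwise disjoint $(t-1)$-dimensional projective subspaces of $\mathrm{PG}(n-1,q)$; let $\mu_q(n,t)$ denote the maximum size of such a set. Let $c_1$ be the integer with $c_1\equiv t-2 \pmod q$ and $0\le c_1<q$, and let $c_2=q$ if $q^2\mid (q-1)(t-2)+c_1$ and $c_2=0$ otherwise. Then $$\mu_q(n,t)\le \frac{q^n-q^{t+r}}{q^t-1}+q^r-(q-1)(t-2)-c_1+c_2,$$ and consequently $$\mu_q(n,t)\le \frac{q^n-q^{t+r}}{q^t-1}+q^r-(q-1)(t-3)+1.$$ -/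

import Mathlib

/-- The number `Θ_i = (q ^ i - 1) / (q - 1)` of points of an `(i - 1)`-dimensional projective
space over a field with `q > 1` elements, as a rational number. -/
def Theta (q i : ℕ) : ℚ := ((q : ℚ) ^ i - 1) / ((q : ℚ) - 1)

/-- `PG(n - 1, q)`, the projective space of the `n`-dimensional vector space over `K`, where `K`
is a field with `q` elements; its points are the lines through the origin of `K ^ n`. -/
abbrev PG (K : Type*) [Field K] (n : ℕ) := Projectivization K (Fin n → K)

/-- The (projective) subspaces of `PG(n - 1, q)`. -/
abbrev PGSubspace (K : Type*) [Field K] (n : ℕ) := Projectivization.Subspace K (Fin n → K)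

/-- `S` is a partial `(t - 1)`-spread of `PG(n - 1, q)`: a set of `(t - 1)`-dimensional projective
subspaces, i.e. subspaces whose underlying vector space has dimension `t`, any two distinct
members of which have no point in common. -/
def IsPartialSpread {K : Type*} [Field K] {n : ℕ} (t : ℕ) (S : Set (PGSubspace K n)) : Prop :=
  (∀ W ∈ S, Module.finrank K W.submodule = t) ∧
    ∀ W ∈ S, ∀ W' ∈ S, W ≠ W' → Disjoint (W : Set (PG K n)) (W' : Set (PG K n))

/-- The maximum size `μ_q(n, t)` of a partial `(t - 1)`-spread of `PG(n - 1, q)`. -/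
noncomputable def maxPartialSpread (K : Type*) [Field K] (n t : ℕ) : ℕ :=
  sSup {m : ℕ | ∃ S : Set (PGSubspace K n), IsPartialSpread t S ∧ S.ncard = m}

/-- A finite projective space has only finitely many subspaces. -/
theorem finite_pgSubspace (K : Type*) [Field K] [Finite K] (n : ℕ) : Finite (PGSubspace K n) :=
  Finite.of_injective (fun W : PGSubspace K n => (W : Set (PG K n))) SetLike.coe_injective

/-- Over a finite field the supremum defining `maxPartialSpread` is an attained maximum. -/
theorem maxPartialSpread_isGreatest (K : Type*) [Field K] [Finite K] (n t : ℕ) :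
    IsGreatest {m : ℕ | ∃ S : Set (PGSubspace K n), IsPartialSpread t S ∧ S.ncard = m}
      (maxPartialSpread K n t) := by
  have hfin := finite_pgSubspace K n
  have hb : BddAbove {m : ℕ | ∃ S : Set (PGSubspace K n), IsPartialSpread t S ∧ S.ncard = m} := by
    refine ⟨Nat.card (PGSubspace K n), ?_⟩
    rintro m ⟨S, -, rfl⟩
    exact Set.ncard_le_card S
  have hne : {m : ℕ | ∃ S : Set (PGSubspace K n),
      IsPartialSpread t S ∧ S.ncard = m}.Nonempty :=
    ⟨0, ∅, by simp [IsPartialSpread], by simp⟩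
  exact ⟨Nat.sSup_mem hne hb, fun m hm => le_csSup hb hm⟩

/-! Suppose a spread had M + y + 1 members, where M is the quotient in the bound and y = q^r -
(q-1)(t-2) - c₁. Its holes (uncovered nonzero vectors) number y + q^t δ with δ = q^r - 1 - y. In a
subspace of codimension i ≤ t the hole count is congruent to y mod q^(t-i), because every member
meets it in dimension at least t - i. Some hyperplane has fewer holes than average, and the
congruences turn this strict inequality into a definite loss. Iterating
(`exists_codim_card_holes_le`) gives a subspace of codimension at most t - s with at most y + q^s (δ
- (q-1)(t-s)) holes. On the other hand, the first two moments of the hyperplane intersections force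
at least y (q^s - y) holes there (`mul_sub_le_card_of_deviation`). Since q divides y, some s makes
the two estimates incompatible (`exists_exponent`). This gives the bound even without c₂; both
stated inequalities are weaker. -/

open Classical in
theorem card_filter_mem_span_singleton {K E : Type*} [Field K] [Fintype K] [AddCommGroup E]
    [Module K E] {A : Finset E} (h0 : (0 : E) ∉ A)
    (hA : ∀ a : K, a ≠ 0 → ∀ v ∈ A, a • v ∈ A) {v : E} (hv : v ∈ A) :
    (A.filter fun w => w ∈ Submodule.span K {v}).card + 1 = Fintype.card K := by
  have hv0 : v ≠ 0 := fun h => h0 (h ▸ hv)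
  have h : A.filter (fun w => w ∈ Submodule.span K {v})
      = (Finset.univ.erase (0 : K)).image fun a => a • v := by
    ext w
    simp only [Finset.mem_filter, Submodule.mem_span_singleton, Finset.mem_image,
      Finset.mem_erase, Finset.mem_univ, and_true]
    constructor
    · rintro ⟨hw, a, rfl⟩
      exact ⟨a, fun ha => h0 (by simpa [ha] using hw), rfl⟩
    · rintro ⟨a, ha, rfl⟩
      exact ⟨hA a ha v hv, a, rfl⟩
  rw [h, Finset.card_image_of_injective _ (smul_left_injective K hv0),
    Finset.card_erase_of_mem (Finset.mem_univ _), Finset.card_univ]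
  exact Nat.sub_add_cancel Fintype.card_pos

/-! ### Moments of kernel intersections over the dual space. -/

section Moments

variable {K E : Type*} [Field K] [Fintype K] [AddCommGroup E] [Module K E] [Fintype E]

open Classical in
/-- The number of functionals vanishing on a subspace of a finite vector space. -/
theorem card_pow_mul_card_dual_vanishing (P : Submodule K E) [Fintype (Module.Dual K E)] :
    Fintype.card K ^ Module.finrank K P *
      (Finset.univ.filter fun f : Module.Dual K E => ∀ v ∈ P, f v = 0).card =
      Fintype.card (Module.Dual K E) := by
  have h1 : (Finset.univ.filter fun f : Module.Dual K E => ∀ v ∈ P, f v = 0).card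
      = Fintype.card P.dualAnnihilator := by
    rw [Fintype.card_subtype]
    congr 1
    ext f
    simp [Submodule.mem_dualAnnihilator]
  rw [h1, Module.card_eq_pow_finrank (K := K) (V := P.dualAnnihilator),
    Module.card_eq_pow_finrank (K := K) (V := Module.Dual K E), ← pow_add,
    Subspace.finrank_add_finrank_dualAnnihilator_eq, Subspace.dual_finrank_eq]

open Classical in
theorem card_mul_card_dual_vanishing {v : E} (hv : v ≠ 0) [Fintype (Module.Dual K E)] :
    Fintype.card K * (Finset.univ.filter fun f : Module.Dual K E => f v = 0).card =
      Fintype.card (Module.Dual K E) := by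
  rw [← card_pow_mul_card_dual_vanishing (Submodule.span K {v}), finrank_span_singleton hv, pow_one]
  congr 2
  ext f
  simp only [Finset.mem_filter, Finset.mem_univ, true_and, Submodule.mem_span_singleton]
  constructor
  · rintro h _ ⟨a, rfl⟩
    simp [h]
  · intro h
    exact h v ⟨1, one_smul _ _⟩

open Classical in
theorem card_sq_mul_card_dual_vanishing_pair {v w : E} (hv : v ≠ 0)
    (hw : w ∉ Submodule.span K {v}) [Fintype (Module.Dual K E)] :
    Fintype.card K ^ 2 *
      (Finset.univ.filter fun f : Module.Dual K E => f v = 0 ∧ f w = 0).card =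
      Fintype.card (Module.Dual K E) := by
  have hli : LinearIndependent K ![v, w] := by
    rw [LinearIndependent.pair_iff' hv]
    intro a ha
    exact hw (Submodule.mem_span_singleton.2 ⟨a, ha⟩)
  have hfr : Module.finrank K (Submodule.span K (Set.range ![v, w])) = 2 := by
    simpa using finrank_span_eq_card hli
  rw [← card_pow_mul_card_dual_vanishing (Submodule.span K (Set.range ![v, w])), hfr]
  congr 2
  ext f
  simp only [Finset.mem_filter, Finset.mem_univ, true_and]
  constructor
  · rintro ⟨h1, h2⟩ u hu
    have hle : Submodule.span K (Set.range ![v, w]) ≤ LinearMap.ker f := by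
      rw [Submodule.span_le]
      rintro _ ⟨i, rfl⟩
      fin_cases i <;> simpa
    exact hle hu
  · intro h
    exact ⟨h v (Submodule.subset_span ⟨0, rfl⟩), h w (Submodule.subset_span ⟨1, rfl⟩)⟩

open Classical in
/-- First moment of the number of elements of `A` in the kernel of a functional. -/
theorem card_mul_sum_card_ker [Fintype (Module.Dual K E)] {A : Finset E} (h0 : (0 : E) ∉ A) :
    Fintype.card K * ∑ f : Module.Dual K E, (A.filter fun v => f v = 0).card =
      Fintype.card (Module.Dual K E) * A.card := by
  simp_rw [Finset.card_filter]
  rw [Finset.sum_comm, Finset.mul_sum, mul_comm, ← smul_eq_mul, ← Finset.sum_const]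
  refine Finset.sum_congr rfl fun v hv => ?_
  rw [← Finset.card_filter]
  exact card_mul_card_dual_vanishing fun h => h0 (h ▸ hv)

open Classical in
/-- Second moment of the number of elements of `A` in the kernel of a functional. -/
theorem card_sq_mul_sum_card_ker_sq [Fintype (Module.Dual K E)] {A : Finset E}
    (h0 : (0 : E) ∉ A) (hA : ∀ a : K, a ≠ 0 → ∀ v ∈ A, a • v ∈ A) :
    (Fintype.card K : ℤ) ^ 2 * ∑ f : Module.Dual K E, ((A.filter fun v => f v = 0).card : ℤ) ^ 2 =
      Fintype.card (Module.Dual K E) *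
        ((A.card : ℤ) ^ 2 + ((Fintype.card K : ℤ) - 1) ^ 2 * A.card) := by
  have hsq : ∀ f : Module.Dual K E, ((A.filter fun v => f v = 0).card : ℤ) ^ 2
      = ∑ v ∈ A, ∑ w ∈ A, if f v = 0 ∧ f w = 0 then (1 : ℤ) else 0 := by
    intro f
    rw [Finset.card_filter]
    push_cast
    rw [sq, Finset.sum_mul_sum]
    refine Finset.sum_congr rfl fun v _ => Finset.sum_congr rfl fun w _ => ?_
    by_cases h1 : f v = 0 <;> by_cases h2 : f w = 0 <;> simp [h1, h2]
  have hin : ∀ v ∈ A, (Fintype.card K : ℤ) ^ 2 * ∑ w ∈ A, ∑ f : Module.Dual K E,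
      (if f v = 0 ∧ f w = 0 then (1 : ℤ) else 0) = Fintype.card (Module.Dual K E) *
        ((A.card : ℤ) + ((Fintype.card K : ℤ) - 1) ^ 2) := by
    intro v hv
    have hv0 : v ≠ 0 := fun h => h0 (h ▸ hv)
    have hspan := card_filter_mem_span_singleton (K := K) h0 hA hv
    have hsplit := Finset.card_filter_add_card_filter_not (s := A)
      (fun w => w ∈ Submodule.span K {v})
    -- The q - 1 multiples of v impose one linear condition on f together with v; every other w
    -- imposes a second, independent one.
    rw [← Finset.sum_filter_add_sum_filter_not A (fun w => w ∈ Submodule.span K {v}),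
      mul_add, Finset.mul_sum, Finset.mul_sum]
    have e1 : ∀ w ∈ A.filter (fun w => w ∈ Submodule.span K {v}),
        (Fintype.card K : ℤ) ^ 2 * ∑ f : Module.Dual K E,
          (if f v = 0 ∧ f w = 0 then (1 : ℤ) else 0) =
          Fintype.card K * Fintype.card (Module.Dual K E) := by
      intro w hw
      obtain ⟨a, rfl⟩ := Submodule.mem_span_singleton.1 (Finset.mem_filter.1 hw).2
      have : ∀ f : Module.Dual K E, (f v = 0 ∧ f (a • v) = 0) ↔ f v = 0 := by
        intro f
        simp +contextual
      simp_rw [this]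
      rw [← card_mul_card_dual_vanishing (K := K) hv0, Finset.sum_boole]
      push_cast
      ring
    have e2 : ∀ w ∈ A.filter (fun w => ¬ w ∈ Submodule.span K {v}),
        (Fintype.card K : ℤ) ^ 2 * ∑ f : Module.Dual K E,
          (if f v = 0 ∧ f w = 0 then (1 : ℤ) else 0) = Fintype.card (Module.Dual K E) := by
      intro w hw
      rw [← card_sq_mul_card_dual_vanishing_pair (K := K) hv0 (Finset.mem_filter.1 hw).2,
        Finset.sum_boole]
      push_cast
      ring
    rw [Finset.sum_congr rfl e1, Finset.sum_congr rfl e2, Finset.sum_const, Finset.sum_const,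
      nsmul_eq_mul, nsmul_eq_mul]
    zify at hspan hsplit
    have h1 : ((A.filter fun w => w ∈ Submodule.span K {v}).card : ℤ)
      = Fintype.card K - 1 := by linarith
    have h2 : ((A.filter fun w => ¬ w ∈ Submodule.span K {v}).card : ℤ)
      = A.card - (Fintype.card K - 1) := by linarith
    rw [h1, h2]
    ring
  simp_rw [hsq]
  rw [Finset.sum_comm, Finset.mul_sum]
  have : ∀ v ∈ A, (Fintype.card K : ℤ) ^ 2 * ∑ f : Module.Dual K E, ∑ w ∈ A,
      (if f v = 0 ∧ f w = 0 then (1 : ℤ) else 0) = Fintype.card (Module.Dual K E) *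
        ((A.card : ℤ) + ((Fintype.card K : ℤ) - 1) ^ 2) := by
    intro v hv
    rw [Finset.sum_comm]
    exact hin v hv
  rw [Finset.sum_congr rfl this, Finset.sum_const, nsmul_eq_mul]
  ring

end Moments

/-! ### Deviation of kernel intersections from their average. -/

section Deviation

variable {K E : Type*} [Field K] [Fintype K] [AddCommGroup E] [Module K E] [Fintype E]

open Classical in
theorem sum_card_ker_sub [Fintype (Module.Dual K E)] {A : Finset E} (h0 : (0 : E) ∉ A) :
    ∑ f : Module.Dual K E,
      ((Fintype.card K : ℤ) * (A.filter fun v => f v = 0).card - A.card) = 0 := by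
  have h := card_mul_sum_card_ker (K := K) h0
  zify at h
  rw [Finset.sum_sub_distrib, ← Finset.mul_sum, h]
  simp

open Classical in
theorem sum_card_ker_sub_sq [Fintype (Module.Dual K E)] {A : Finset E} (h0 : (0 : E) ∉ A)
    (hA : ∀ a : K, a ≠ 0 → ∀ v ∈ A, a • v ∈ A) :
    ∑ f : Module.Dual K E,
      ((Fintype.card K : ℤ) * (A.filter fun v => f v = 0).card - A.card) ^ 2 =
      Fintype.card (Module.Dual K E) * (((Fintype.card K : ℤ) - 1) ^ 2 * A.card) := by
  have h1 := card_mul_sum_card_ker (K := K) h0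
  have h2 := card_sq_mul_sum_card_ker_sq (K := K) h0 hA
  zify at h1
  have hexp : ∀ f : Module.Dual K E,
      ((Fintype.card K : ℤ) * (A.filter fun v => f v = 0).card - A.card) ^ 2 =
      (Fintype.card K : ℤ) ^ 2 * ((A.filter fun v => f v = 0).card : ℤ) ^ 2
        - 2 * A.card * ((Fintype.card K : ℤ) * (A.filter fun v => f v = 0).card)
        + (A.card : ℤ) ^ 2 := fun f => by ring
  simp_rw [hexp]
  rw [Finset.sum_add_distrib, Finset.sum_sub_distrib, ← Finset.mul_sum, ← Finset.mul_sum,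
    ← Finset.mul_sum, h1, h2]
  simp
  ring

open Classical in
/-- Some hyperplane contains fewer elements of `A` than the average. -/
theorem exists_card_mul_card_ker_lt [Finite (Module.Dual K E)] {A : Finset E} (h0 : (0 : E) ∉ A)
    (hpos : A.Nonempty) :
    ∃ f : Module.Dual K E, (Fintype.card K : ℤ) * (A.filter fun v => f v = 0).card < A.card := by
  have := Fintype.ofFinite (Module.Dual K E)
  have hsum := sum_card_ker_sub (K := K) h0
  by_contra! hcon
  -- The zero functional has the strictly positive deviation (q-1)|A|, so the others cannot all be
  -- nonnegative.
  have hzero := (Finset.sum_eq_zero_iff_of_nonneg (fun f _ => sub_nonneg.2 (hcon f))).1 hsum 0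
    (Finset.mem_univ _)
  have hq : (1 : ℤ) < Fintype.card K := by exact_mod_cast Fintype.one_lt_card
  have hA : (0 : ℤ) < A.card := by exact_mod_cast hpos.card_pos
  simp at hzero
  nlinarith

open Classical in
/-- If the deviations of the hyperplane intersections from their average all lie in one residue
class, then `A` cannot be too small. -/
theorem mul_sub_le_card_of_deviation [Finite (Module.Dual K E)] {A : Finset E}
    (h0 : (0 : E) ∉ A) (hA : ∀ a : K, a ≠ 0 → ∀ v ∈ A, a • v ∈ A) {y Q : ℤ}
    (hdev : ∀ f : Module.Dual K E, ∃ j : ℤ,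
      (Fintype.card K : ℤ) * (A.filter fun v => f v = 0).card - A.card
        = ((Fintype.card K : ℤ) - 1) * (y + Q * j)) :
    y * (Q - y) ≤ A.card := by
  have := Fintype.ofFinite (Module.Dual K E)
  have h1 := sum_card_ker_sub (K := K) h0
  have h2 := sum_card_ker_sub_sq (K := K) h0 hA
  have hq : (1 : ℤ) < (Fintype.card K : ℤ) := by exact_mod_cast Fintype.one_lt_card
  set q : ℤ := (Fintype.card K : ℤ)
  set X : Module.Dual K E → ℤ := fun f => q * (A.filter fun v => f v = 0).card - A.card
  -- The roots are the consecutive admissible values j = 0 and j = -1, so no integer j makes a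
  -- summand negative.
  have hnn : 0 ≤ ∑ f, (X f - (q - 1) * y) * (X f - (q - 1) * y + (q - 1) * Q) := by
    refine Finset.sum_nonneg fun f _ => ?_
    obtain ⟨j, hj⟩ := hdev f
    have hX : X f = (q - 1) * (y + Q * j) := hj
    have hj0 : 0 ≤ j * (j + 1) := by
      rcases le_or_gt 0 j with h | h
      · positivity
      · exact mul_nonneg_of_nonpos_of_nonpos h.le (by omega)
    rw [hX]
    have : ((q - 1) * (y + Q * j) - (q - 1) * y) *
        ((q - 1) * (y + Q * j) - (q - 1) * y + (q - 1) * Q)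
        = ((q - 1) * Q) ^ 2 * (j * (j + 1)) := by ring
    rw [this]
    positivity
  have hexp : ∀ f, (X f - (q - 1) * y) * (X f - (q - 1) * y + (q - 1) * Q)
      = X f ^ 2 + (q - 1) * (Q - 2 * y) * X f + (q - 1) ^ 2 * (y * (y - Q)) := fun f => by ring
  simp_rw [hexp] at hnn
  rw [Finset.sum_add_distrib, Finset.sum_add_distrib, ← Finset.mul_sum, h1, h2, Finset.sum_const,
    nsmul_eq_mul, Finset.card_univ] at hnn
  have hD : (0 : ℤ) < Fintype.card (Module.Dual K E) := by exact_mod_cast Fintype.card_pos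
  have hprod : 0 ≤ (Fintype.card (Module.Dual K E) * (q - 1) ^ 2) * (A.card - y * (Q - y)) := by
    linarith
  have hc : 0 < Fintype.card (Module.Dual K E) * (q - 1) ^ 2 :=
    mul_pos hD (pow_pos (by linarith) 2)
  linarith [nonneg_of_mul_nonneg_right hprod hc]

end Deviation

/-! ### Holes: congruences and descent through hyperplanes. -/

section Holes

variable {K E : Type*} [Field K] [AddCommGroup E] [Module K E] [Fintype E]

open Classical in
/-- The nonzero vectors of `U` which lie in no member of `S`. -/
noncomputable def holes (S : Finset (Submodule K E)) (U : Submodule K E) : Finset E :=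
  Finset.univ.filter fun v => v ≠ 0 ∧ v ∈ U ∧ ∀ W ∈ S, v ∉ W

theorem zero_notMem_holes (S : Finset (Submodule K E)) (U : Submodule K E) :
    (0 : E) ∉ holes S U := by
  simp [holes]

theorem smul_mem_holes {S : Finset (Submodule K E)} {U : Submodule K E} {a : K} (ha : a ≠ 0)
    {v : E} (hv : v ∈ holes S U) : a • v ∈ holes S U := by
  simp only [holes, Finset.mem_filter, Finset.mem_univ, true_and] at hv ⊢
  exact ⟨smul_ne_zero ha hv.1, U.smul_mem a hv.2.1,
    fun W hW h => hv.2.2 W hW ((W.smul_mem_iff ha).1 h)⟩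

open Classical in
theorem holes_filter_ker (S : Finset (Submodule K E)) (U : Submodule K E) (f : Module.Dual K E) :
    (holes S U).filter (fun v => f v = 0) = holes S (U ⊓ LinearMap.ker f) := by
  ext v
  simp only [holes, Finset.mem_filter, Finset.mem_univ, true_and, Submodule.mem_inf,
    LinearMap.mem_ker]
  tauto

theorem finrank_le_finrank_inf_ker_add_one (U : Submodule K E) (f : Module.Dual K E) :
    Module.finrank K U ≤ Module.finrank K ↥(U ⊓ LinearMap.ker f) + 1 := by
  have h1 := Submodule.finrank_sup_add_finrank_inf_eq U (LinearMap.ker f)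
  have h2 := Submodule.finrank_le (U ⊔ LinearMap.ker f)
  have h3 := LinearMap.finrank_range_add_finrank_ker f
  have h4 := Submodule.finrank_le (LinearMap.range f)
  rw [Module.finrank_self] at h4
  omega

variable [Fintype K]

open Classical in
theorem card_filter_ne_zero_mem (U : Submodule K E) :
    ((Finset.univ.filter fun v : E => v ≠ 0 ∧ v ∈ U).card : ℤ)
      = (Fintype.card K : ℤ) ^ Module.finrank K U - 1 := by
  have h1 : (Finset.univ.filter fun v : E => v ≠ 0 ∧ v ∈ U)
      = (Finset.univ.filter fun v : E => v ∈ U).erase 0 := by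
    ext v
    simp
  have h2 : (Finset.univ.filter fun v : E => v ∈ U).card
      = Fintype.card K ^ Module.finrank K U := by
    rw [← Module.card_eq_pow_finrank (K := K) (V := U), Fintype.card_subtype]
  rw [h1, Finset.card_erase_of_mem (by simp), h2, Nat.cast_sub (Nat.one_le_pow _ _ Fintype.card_pos)]
  push_cast
  rfl

theorem card_holes_eq {S : Finset (Submodule K E)}
    (hS : ∀ W ∈ S, ∀ W' ∈ S, W ≠ W' → Disjoint W W') (U : Submodule K E) :
    ((holes S U).card : ℤ) = (Fintype.card K : ℤ) ^ Module.finrank K U - 1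
      - ∑ W ∈ S, ((Fintype.card K : ℤ) ^ Module.finrank K ↥(W ⊓ U) - 1) := by
  classical
  have hsplit : (Finset.univ.filter fun v : E => v ≠ 0 ∧ v ∈ U)
      = (holes S U) ∪ S.biUnion fun W => Finset.univ.filter fun v : E => v ≠ 0 ∧ v ∈ W ⊓ U := by
    ext v
    simp only [holes, Finset.mem_filter, Finset.mem_univ, true_and, Finset.mem_union,
      Finset.mem_biUnion, Submodule.mem_inf]
    constructor
    · rintro ⟨h1, h2⟩
      by_cases h : ∃ W ∈ S, v ∈ W
      · obtain ⟨W, hW, hvW⟩ := h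
        exact Or.inr ⟨W, hW, h1, hvW, h2⟩
      · push Not at h
        exact Or.inl ⟨h1, h2, h⟩
    · rintro (⟨h1, h2, -⟩ | ⟨W, -, h1, -, h2⟩) <;> exact ⟨h1, h2⟩
  have hd : Disjoint (holes S U)
      (S.biUnion fun W => Finset.univ.filter fun v : E => v ≠ 0 ∧ v ∈ W ⊓ U) := by
    rw [Finset.disjoint_left]
    intro v hv hv'
    simp only [holes, Finset.mem_filter, Finset.mem_univ, true_and, Finset.mem_biUnion,
      Submodule.mem_inf] at hv hv'
    obtain ⟨W, hW, -, hvW, -⟩ := hv'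
    exact hv.2.2 W hW hvW
  have hpd : (S : Set (Submodule K E)).PairwiseDisjoint
      fun W => Finset.univ.filter fun v : E => v ≠ 0 ∧ v ∈ W ⊓ U := by
    intro W hW W' hW' hne
    rw [Function.onFun, Finset.disjoint_left]
    intro v hv hv'
    simp only [Finset.mem_filter, Finset.mem_univ, true_and, Submodule.mem_inf] at hv hv'
    exact hv.1 (Submodule.disjoint_def.1 (hS W hW W' hW' hne) v hv.2.1 hv'.2.1)
  have hcard := congrArg (fun F : Finset E => (F.card : ℤ)) hsplit
  simp only [Finset.card_union_of_disjoint hd, Finset.card_biUnion hpd] at hcard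
  push_cast at hcard
  rw [card_filter_ne_zero_mem, Finset.sum_congr rfl fun W _ => card_filter_ne_zero_mem (W ⊓ U)]
    at hcard
  linarith

theorem sub_one_dvd_card_holes {S : Finset (Submodule K E)}
    (hS : ∀ W ∈ S, ∀ W' ∈ S, W ≠ W' → Disjoint W W') (U : Submodule K E) :
    ((Fintype.card K : ℤ) - 1) ∣ (holes S U).card := by
  rw [card_holes_eq hS]
  exact dvd_sub (sub_one_dvd_pow_sub_one _ _)
    (Finset.dvd_sum fun W _ => sub_one_dvd_pow_sub_one _ _)

/-- Each member meets U in dimension at least t - i ≥ s, so modulo q^s only the constants -1 in the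
count survive. -/
theorem pow_dvd_card_holes_sub {S : Finset (Submodule K E)}
    (hS : ∀ W ∈ S, ∀ W' ∈ S, W ≠ W' → Disjoint W W') {t i s : ℕ}
    (hdim : ∀ W ∈ S, Module.finrank K W = t) (ht : t ≤ Module.finrank K E)
    {U : Submodule K E} (hU : Module.finrank K E ≤ Module.finrank K U + i) (his : s + i ≤ t) :
    (Fintype.card K : ℤ) ^ s ∣ (holes S U).card - ((S.card : ℤ) - 1) := by
  have h : ((holes S U).card : ℤ) - ((S.card : ℤ) - 1)
      = (Fintype.card K : ℤ) ^ Module.finrank K U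
        - ∑ W ∈ S, (Fintype.card K : ℤ) ^ Module.finrank K ↥(W ⊓ U) := by
    rw [card_holes_eq hS, Finset.sum_sub_distrib]
    simp
    ring
  rw [h]
  refine dvd_sub (pow_dvd_pow _ (by omega)) (Finset.dvd_sum fun W hW => pow_dvd_pow _ ?_)
  have h1 := Submodule.finrank_sup_add_finrank_inf_eq W U
  have h2 := Submodule.finrank_le (W ⊔ U)
  rw [hdim W hW] at h1
  omega

/-- The deviation of a hyperplane intersection of the holes from its average. -/
theorem exists_deviation {S : Finset (Submodule K E)}
    (hS : ∀ W ∈ S, ∀ W' ∈ S, W ≠ W' → Disjoint W W') {t i s : ℕ}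
    (hdim : ∀ W ∈ S, Module.finrank K W = t) (ht : t ≤ Module.finrank K E) {y : ℤ}
    (hy : (Fintype.card K : ℤ) ^ t ∣ (S.card : ℤ) - 1 - y)
    {U : Submodule K E} (hU : Module.finrank K E ≤ Module.finrank K U + i)
    (his : s + 1 + i = t) (f : Module.Dual K E) :
    ∃ j : ℤ, (Fintype.card K : ℤ) * (holes S (U ⊓ LinearMap.ker f)).card - (holes S U).card
      = ((Fintype.card K : ℤ) - 1) * (y + (Fintype.card K : ℤ) ^ (s + 1) * j) := by
  have hU' := finrank_le_finrank_inf_ker_add_one U f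
  have d1 := pow_dvd_card_holes_sub hS hdim ht hU (s := s + 1) (by omega)
  have d2 := pow_dvd_card_holes_sub hS hdim ht (U := U ⊓ LinearMap.ker f) (i := i + 1) (s := s)
    (by omega) (by omega)
  have e1 := sub_one_dvd_card_holes hS U
  have e2 := sub_one_dvd_card_holes hS (U ⊓ LinearMap.ker f)
  set q : ℤ := (Fintype.card K : ℤ)
  obtain ⟨a, ha⟩ := dvd_add d1 ((pow_dvd_pow q (show s + 1 ≤ t by omega)).trans hy)
  obtain ⟨b, hb⟩ := dvd_add d2 ((pow_dvd_pow q (show s ≤ t by omega)).trans hy)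
  have hX : q * (holes S (U ⊓ LinearMap.ker f)).card - (holes S U).card
      = (q - 1) * y + q ^ (s + 1) * (b - a) := by
    linear_combination q * hb - ha
  have hdvd : (q - 1) ∣ q ^ (s + 1) * (b - a) := by
    have h := dvd_sub (dvd_mul_of_dvd_right e2 q) e1
    rw [hX] at h
    exact (dvd_add_right (dvd_mul_right _ _)).1 h
  -- Holes are closed under nonzero scalars, so q - 1 divides both counts; coprimality moves this
  -- factor onto b - a.
  have hcop : IsCoprime (q - 1) (q ^ (s + 1)) :=
    IsCoprime.pow_right ⟨-1, 1, by ring⟩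
  obtain ⟨j, hj⟩ := hcop.dvd_of_dvd_mul_left hdvd
  exact ⟨j, by rw [hX, hj]; ring⟩

/-- Successively passing to hyperplanes containing few holes. -/
theorem exists_codim_card_holes_le {S : Finset (Submodule K E)}
    (hS : ∀ W ∈ S, ∀ W' ∈ S, W ≠ W' → Disjoint W W') {t : ℕ}
    (hdim : ∀ W ∈ S, Module.finrank K W = t) (ht : t ≤ Module.finrank K E) {y δ : ℤ}
    (hy : (Fintype.card K : ℤ) ^ t ∣ (S.card : ℤ) - 1 - y) (hy0 : 0 < y)
    (hδ : ((holes S ⊤).card : ℤ) = y + (Fintype.card K : ℤ) ^ t * δ) {s : ℕ}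
    (hys : y < (Fintype.card K : ℤ) ^ s) (i : ℕ) (hi : s + i ≤ t) :
    ∃ U : Submodule K E, Module.finrank K E ≤ Module.finrank K U + i ∧
      ((holes S U).card : ℤ) ≤
        y + (Fintype.card K : ℤ) ^ (t - i) * (δ - ((Fintype.card K : ℤ) - 1) * i) := by
  classical
  have hq : (1 : ℤ) < Fintype.card K := by exact_mod_cast Fintype.one_lt_card
  induction i with
  | zero => exact ⟨⊤, by simp, by simp [hδ]⟩
  | succ i ih =>
    obtain ⟨U, hU, hle⟩ := ih (by omega)
    have hfin : Finite (Module.Dual K E) := DFunLike.finite _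
    obtain ⟨p, rfl⟩ : ∃ p, t = p + 1 + i := ⟨t - 1 - i, by omega⟩
    have hyp : y < (Fintype.card K : ℤ) ^ (p + 1) :=
      hys.trans_le (pow_le_pow_right₀ hq.le (by omega))
    -- The count is y mod q^(p+1) and 0 < y < q^(p+1), so it cannot vanish.
    have hne : (holes S U).Nonempty := by
      rw [Finset.nonempty_iff_ne_empty]
      intro hem
      have d := pow_dvd_card_holes_sub hS hdim ht hU (s := p + 1) le_rfl
      have d' := dvd_add d ((pow_dvd_pow _ (show p + 1 ≤ p + 1 + i by omega)).trans hy)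
      rw [hem] at d'
      have d2 : (Fintype.card K : ℤ) ^ (p + 1) ∣ y := by
        rw [← dvd_neg]
        convert d' using 1
        rw [Finset.card_empty]
        push_cast
        ring
      exact absurd (Int.le_of_dvd hy0 d2) (not_le.2 hyp)
    obtain ⟨f, hf⟩ := exists_card_mul_card_ker_lt (K := K) (zero_notMem_holes S U) hne
    rw [holes_filter_ker] at hf
    obtain ⟨j, hj⟩ := exists_deviation hS hdim ht hy hU rfl f
    refine ⟨U ⊓ LinearMap.ker f, ?_, ?_⟩
    · have := finrank_le_finrank_inf_ker_add_one U f
      omega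
    rw [show p + 1 + i - i = p + 1 by omega] at hle
    rw [show p + 1 + i - (i + 1) = p by omega]
    set q : ℤ := (Fintype.card K : ℤ)
    -- A negative deviation excludes j ≥ 0, as y > 0; this is the gain at each step.
    have hj0 : j ≤ -1 := by
      by_contra! h
      have h1 : 0 ≤ q ^ (p + 1) * j := mul_nonneg (by positivity) (by omega)
      have h2 : 0 < (q - 1) * (y + q ^ (p + 1) * j) := mul_pos (by linarith) (by linarith)
      linarith
    have hstep : (q - 1) * (y + q ^ (p + 1) * j) ≤ (q - 1) * (y + q ^ (p + 1) * (-1)) := by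
      have : 0 < q ^ (p + 1) := by positivity
      gcongr
    have hfinal : q * (holes S (U ⊓ LinearMap.ker f)).card
        ≤ q * (y + q ^ p * (δ - (q - 1) * ((i + 1 : ℕ) : ℤ))) := by
      push_cast
      rw [pow_succ] at hstep hle hj
      linarith
    exact le_of_mul_le_mul_left hfinal (by linarith)

theorem mul_sub_le_of_holes {S : Finset (Submodule K E)}
    (hS : ∀ W ∈ S, ∀ W' ∈ S, W ≠ W' → Disjoint W W') {t : ℕ}
    (hdim : ∀ W ∈ S, Module.finrank K W = t) (ht : t ≤ Module.finrank K E) {y δ : ℤ}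
    (hy : (Fintype.card K : ℤ) ^ t ∣ (S.card : ℤ) - 1 - y) (hy0 : 0 < y)
    (hδ : ((holes S ⊤).card : ℤ) = y + (Fintype.card K : ℤ) ^ t * δ) {s : ℕ}
    (hs : 1 ≤ s) (hst : s ≤ t) (hys : y < (Fintype.card K : ℤ) ^ s) :
    y * ((Fintype.card K : ℤ) ^ s - y) ≤
      y + (Fintype.card K : ℤ) ^ s * (δ - ((Fintype.card K : ℤ) - 1) * ((t : ℤ) - s)) := by
  classical
  have hfin : Finite (Module.Dual K E) := DFunLike.finite _
  obtain ⟨U, hU, hle⟩ := exists_codim_card_holes_le hS hdim ht hy hy0 hδ hys (t - s) (by omega)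
  rw [show t - (t - s) = s by omega, Nat.cast_sub hst] at hle
  refine le_trans (mul_sub_le_card_of_deviation (K := K) (zero_notMem_holes S U)
    (fun a ha v hv => smul_mem_holes ha hv) fun f => ?_) hle
  obtain ⟨p, rfl⟩ : ∃ p, s = p + 1 := ⟨s - 1, by omega⟩
  rw [holes_filter_ker]
  exact exists_deviation hS hdim ht hy hU (by omega) f

end Holes

/-! ### Choice of the exponent s. -/

section Numeric

/-- With m = ⌊log_q Y⌋ and s = m + 3, the gap q^s - qY exceeds (q-1) q^(m+2), so it suffices that
(q-1)(m+1) + c - 1 < (q-1)Y. This follows from m + 2 ≤ Y, which fails only for Y = 1 and for q = Y =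
2; those cases take s = 2 and s = 3. -/
theorem exists_exponent_of_digits {q r t Y : ℕ} (hq : 2 ≤ q) (hrt : r < t) (hr : 2 ≤ r)
    (hY : 1 ≤ Y) (hYr : q * Y < q ^ r) {c : ℤ} (hc : c < q) :
    ∃ s : ℕ, 2 ≤ s ∧ s ≤ t ∧ (q : ℤ) * Y < (q : ℤ) ^ s ∧
      (q : ℤ) * Y + (q : ℤ) ^ s * (((q : ℤ) - 1) * ((s : ℤ) - 2) + c - 1) <
        (q : ℤ) * Y * ((q : ℤ) ^ s - (q : ℤ) * Y) := by
  have hq' : (2 : ℤ) ≤ q := by exact_mod_cast hq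
  by_cases h1 : Y = 1
  · subst h1
    refine ⟨2, le_rfl, by omega, by push_cast; nlinarith, ?_⟩
    push_cast
    have : (q : ℤ) ^ 2 * (c - 1) ≤ (q : ℤ) ^ 2 * (q - 2) :=
      mul_le_mul_of_nonneg_left (by omega) (by positivity)
    nlinarith
  by_cases h2 : q = 2 ∧ Y = 2
  · obtain ⟨rfl, rfl⟩ := h2
    refine ⟨3, by omega, by omega, by norm_num, ?_⟩
    push_cast at hc ⊢
    linarith
  set m := Nat.log q Y with hm
  have hlow : q ^ m ≤ Y := Nat.pow_log_le_self q (by omega)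
  have hup : Y < q ^ (m + 1) := Nat.lt_pow_succ_log_self (by omega) Y
  have hmY : m + 2 ≤ Y := by
    rcases m with _ | _ | m
    · omega
    · simp only [zero_add, pow_one] at hlow
      omega
    · have h4 : m + 4 ≤ 2 ^ (m + 1 + 1) := by
        have := Nat.lt_two_pow_self (n := m)
        rw [pow_succ, pow_succ]
        omega
      exact h4.trans ((Nat.pow_le_pow_left hq (m + 1 + 1)).trans hlow)
  have hmr : m + 1 < r := by
    refine (Nat.pow_lt_pow_iff_right (a := q) (by omega)).1 (lt_of_le_of_lt ?_ hYr)
    rw [pow_succ, mul_comm]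
    exact Nat.mul_le_mul_left q hlow
  have hyP : (q : ℤ) * Y + 1 ≤ (q : ℤ) ^ (m + 2) := by
    have : q * Y < q ^ (m + 2) := by
      rw [pow_succ', mul_lt_mul_iff_right₀ (by omega)]
      exact hup
    exact_mod_cast this
  have hyL : (m : ℤ) + 2 ≤ Y := by exact_mod_cast hmY
  have hP : (0 : ℤ) < (q : ℤ) ^ (m + 2) := by positivity
  refine ⟨m + 3, by omega, by omega, ?_, ?_⟩
  · rw [pow_succ (q : ℤ) (m + 2)]
    nlinarith
  · rw [pow_succ (q : ℤ) (m + 2)]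
    push_cast
    set P : ℤ := (q : ℤ) ^ (m + 2)
    have hc1 : ((q : ℤ) - 1) * ((m : ℤ) + 3 - 2) + c - 1 < ((q : ℤ) - 1) * Y := by
      have := mul_le_mul_of_nonneg_left hyL (show (0 : ℤ) ≤ (q : ℤ) - 1 by linarith)
      linarith
    have hlt := mul_lt_mul_of_pos_left hc1 (show 0 < P * (q : ℤ) by positivity)
    have hge := mul_le_mul_of_nonneg_left hyP (show (0 : ℤ) ≤ (q : ℤ) * Y by positivity)
    linarith

theorem exists_exponent {q r t : ℕ} (hq : 2 ≤ q) (hr : 2 ≤ r) (hrt : r < t)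
    (ht : ((q : ℤ) - 1) * t ≤ (q : ℤ) ^ r - 1) {c y : ℤ} (hc : c ≡ (t : ℤ) - 2 [ZMOD (q : ℤ)])
    (hc0 : 0 ≤ c) (hcq : c < q) (hy : y = (q : ℤ) ^ r - ((q : ℤ) - 1) * ((t : ℤ) - 2) - c) :
    0 < y ∧ ∃ s : ℕ, 2 ≤ s ∧ s ≤ t ∧ y < (q : ℤ) ^ s ∧
      y + (q : ℤ) ^ s * (((q : ℤ) - 1) * ((s : ℤ) - 2) + c - 1) < y * ((q : ℤ) ^ s - y) := by
  have hq' : (2 : ℤ) ≤ q := by exact_mod_cast hq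
  -- The hypothesis t ≤ Θ_r gives y ≥ 2(q-1) + 1 - c.
  have hypos : 0 < y := by linarith
  have ht3 : (3 : ℤ) ≤ t := by exact_mod_cast (by omega : 3 ≤ t)
  have hyr : y < (q : ℤ) ^ r := by nlinarith
  -- The role of c: subtracting it rounds q^r - (q-1)(t-2) down to a multiple of q.
  have hdvd : (q : ℤ) ∣ y := by
    have h1 : (q : ℤ) ∣ (t : ℤ) - 2 - c := hc.dvd
    have h2 : (q : ℤ) ∣ (q : ℤ) ^ r := dvd_pow_self _ (by omega)
    have : y = (q : ℤ) ^ r - (q : ℤ) * ((t : ℤ) - 2) + ((t : ℤ) - 2 - c) := by rw [hy]; ring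
    rw [this]
    exact dvd_add (dvd_sub h2 (dvd_mul_right _ _)) h1
  refine ⟨hypos, ?_⟩
  obtain ⟨Y, hY⟩ := hdvd
  have hY0 : 0 < Y := by
    by_contra! h
    nlinarith
  lift Y to ℕ using hY0.le
  rw [hY] at hyr ⊢
  exact exists_exponent_of_digits hq hrt hr (by exact_mod_cast hY0) (by exact_mod_cast hyr) hcq

end Numeric

/-! ### The contradiction and the projective statement. -/

section Bound

/-- Upper bound for the size of a partial spread of vector subspaces. -/
theorem card_partialSpread_le {K E : Type*} [Field K] [Fintype K] [AddCommGroup E] [Module K E]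
    [Fintype E] {t r : ℕ} (hr : 2 ≤ r) (hrt : r < t)
    (ht : ((Fintype.card K : ℤ) - 1) * t ≤ (Fintype.card K : ℤ) ^ r - 1)
    (hn : t ≤ Module.finrank K E) {c M : ℤ} (hc : c ≡ (t : ℤ) - 2 [ZMOD (Fintype.card K : ℤ)])
    (hc0 : 0 ≤ c) (hcq : c < (Fintype.card K : ℤ))
    (hM : (Fintype.card K : ℤ) ^ Module.finrank K E - (Fintype.card K : ℤ) ^ (t + r) =
      M * ((Fintype.card K : ℤ) ^ t - 1)) (hMdvd : (Fintype.card K : ℤ) ^ t ∣ M) (hM0 : 0 ≤ M)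
    (S : Finset (Submodule K E)) (hS : ∀ W ∈ S, ∀ W' ∈ S, W ≠ W' → Disjoint W W')
    (hdim : ∀ W ∈ S, Module.finrank K W = t) :
    (S.card : ℤ) ≤
      M + (Fintype.card K : ℤ) ^ r - ((Fintype.card K : ℤ) - 1) * ((t : ℤ) - 2) - c := by
  by_contra! hlt
  obtain ⟨hy0, s, hs2, hst, hys, hbig⟩ := exists_exponent (Nat.succ_le_of_lt Fintype.one_lt_card)
    hr hrt ht hc hc0 hcq rfl
  set q : ℤ := (Fintype.card K : ℤ)
  set y : ℤ := q ^ r - (q - 1) * ((t : ℤ) - 2) - c with hy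
  -- Trimming to exactly M + y + 1 members makes |T| - 1 congruent to y mod q^t, since q^t divides
  -- M.
  obtain ⟨T, hTS, hT⟩ := Finset.exists_subset_card_eq
    (show (M + y + 1).toNat ≤ S.card by omega)
  have hTc : (T.card : ℤ) = M + y + 1 := by omega
  have hTd : ∀ W ∈ T, ∀ W' ∈ T, W ≠ W' → Disjoint W W' :=
    fun W hW W' hW' => hS W (hTS hW) W' (hTS hW')
  have hTt : ∀ W ∈ T, Module.finrank K W = t := fun W hW => hdim W (hTS hW)
  have hholes : ((holes T ⊤).card : ℤ) = y + q ^ t * (q ^ r - 1 - y) := by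
    rw [card_holes_eq hTd]
    have : ∀ W ∈ T, (q ^ Module.finrank K ↥(W ⊓ ⊤) - 1 : ℤ) = q ^ t - 1 := by
      intro W hW
      rw [inf_top_eq, hTt W hW]
    rw [Finset.sum_congr rfl this, Finset.sum_const, nsmul_eq_mul, hTc, finrank_top]
    rw [pow_add] at hM
    linear_combination hM
  have hmain := mul_sub_le_of_holes hTd hTt hn (y := y) (by rw [hTc]; simpa using hMdvd) hy0
    hholes (by omega : 1 ≤ s) hst hys
  -- Here t cancels, leaving the expression that s was chosen to beat.
  have he : q ^ r - 1 - y - (q - 1) * ((t : ℤ) - s) = (q - 1) * ((s : ℤ) - 2) + c - 1 := by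
    rw [hy]
    ring
  rw [he] at hmain
  linarith

/-- Disjoint projective subspaces have disjoint underlying vector subspaces. -/
theorem disjoint_submodule {K : Type*} [Field K] {n : ℕ} {W W' : PGSubspace K n}
    (h : Disjoint (W : Set (PG K n)) (W' : Set (PG K n))) :
    Disjoint W.submodule W'.submodule := by
  rw [Submodule.disjoint_def]
  intro v hv hv'
  by_contra hv0
  rw [Projectivization.Subspace.mem_submodule_iff _ hv0] at hv hv'
  exact Set.disjoint_left.1 h hv hv'

theorem exists_partialSpread_quotient (q n t r : ℕ) (hnt : t < n) (hrt : r < t)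
    (hmod : r ≡ n [MOD t]) :
    ∃ M : ℕ, (q : ℤ) ^ n - (q : ℤ) ^ (t + r) = M * ((q : ℤ) ^ t - 1) ∧ q ^ t ∣ M := by
  obtain ⟨k, hk⟩ : ∃ k, n = t + r + t * k := by
    have h1 : n % t = r := by rw [← hmod, Nat.mod_eq_of_lt hrt]
    have h2 := Nat.mod_add_div n t
    obtain ⟨k, hk⟩ : ∃ k, n / t = k + 1 :=
      Nat.exists_eq_add_one.2 (Nat.div_pos hnt.le (by omega))
    refine ⟨k, ?_⟩
    rw [h1, hk] at h2
    linarith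
  refine ⟨q ^ (t + r) * ∑ i ∈ Finset.range k, (q ^ t) ^ i, ?_,
    (pow_dvd_pow q (by omega)).mul_right _⟩
  push_cast
  rw [mul_assoc, geom_sum_mul, hk, pow_add (q : ℤ) (t + r), pow_mul]
  ring

theorem theorem1p6 (K : Type*) [Field K] [Finite K] (q n t r : ℕ) (hq : Nat.card K = q)
    (hnt : t < n) (hr : 2 ≤ r) (hrt : r < t) (ht : (t : ℚ) ≤ Theta q r) (hmod : r ≡ n [MOD t])
    (c₁ c₂ : ℤ) (hc₁ : c₁ ≡ (t : ℤ) - 2 [ZMOD (q : ℤ)]) (hc₁_nonneg : 0 ≤ c₁)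
    (hc₁_lt : c₁ < (q : ℤ))
    (hc₂ : c₂ = if (q : ℤ) ^ 2 ∣ ((q : ℤ) - 1) * ((t : ℤ) - 2) + c₁ then (q : ℤ) else 0) :
    (maxPartialSpread K n t : ℚ) ≤
        ((q : ℚ) ^ n - (q : ℚ) ^ (t + r)) / ((q : ℚ) ^ t - 1) + (q : ℚ) ^ r
          - ((q : ℚ) - 1) * ((t : ℚ) - 2) - (c₁ : ℚ) + (c₂ : ℚ) ∧
      (maxPartialSpread K n t : ℚ) ≤
        ((q : ℚ) ^ n - (q : ℚ) ^ (t + r)) / ((q : ℚ) ^ t - 1) + (q : ℚ) ^ r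
          - ((q : ℚ) - 1) * ((t : ℚ) - 3) + 1 := by
  classical
  have := Fintype.ofFinite K
  have := finite_pgSubspace K n
  rw [Nat.card_eq_fintype_card] at hq
  have hq2 : 1 < q := hq ▸ Fintype.one_lt_card
  have hqQ : (1 : ℚ) < q := by exact_mod_cast hq2
  obtain ⟨M, hM, hMdvd⟩ := exists_partialSpread_quotient q n t r hnt hrt hmod
  have htZ : ((q : ℤ) - 1) * t ≤ (q : ℤ) ^ r - 1 := by
    rw [Theta, le_div_iff₀ (by linarith), mul_comm] at ht
    exact_mod_cast ht
  obtain ⟨S, ⟨hSdim, hSdisj⟩, hScard⟩ := (maxPartialSpread_isGreatest K n t).1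
  set T : Finset (Submodule K (Fin n → K)) :=
    S.toFinite.toFinset.image fun W => Projectivization.Subspace.submodule W with hT
  have hTcard : T.card = maxPartialSpread K n t := by
    rw [hT, Finset.card_image_of_injective _ (Projectivization.Subspace.submodule).injective,
      ← Set.ncard_eq_toFinset_card, hScard]
  have hbound : (T.card : ℤ) ≤ M + (q : ℤ) ^ r - ((q : ℤ) - 1) * ((t : ℤ) - 2) - c₁ := by
    subst hq
    refine card_partialSpread_le hr hrt htZ (by simpa using hnt.le) hc₁ hc₁_nonneg hc₁_lt
      (by simpa using hM) (by exact_mod_cast hMdvd) (by positivity) T ?_ ?_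
    · intro W hW W' hW' hne
      simp only [hT, Finset.mem_image, Set.Finite.mem_toFinset] at hW hW'
      obtain ⟨V, hV, rfl⟩ := hW
      obtain ⟨V', hV', rfl⟩ := hW'
      exact disjoint_submodule (hSdisj V hV V' hV' fun h => hne (h ▸ rfl))
    · intro W hW
      simp only [hT, Finset.mem_image, Set.Finite.mem_toFinset] at hW
      obtain ⟨V, hV, rfl⟩ := hW
      exact hSdim V hV
  rw [hTcard] at hbound
  have hboundQ : (maxPartialSpread K n t : ℚ) ≤
      M + (q : ℚ) ^ r - ((q : ℚ) - 1) * ((t : ℚ) - 2) - c₁ := by exact_mod_cast hbound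
  have hMQ : ((q : ℚ) ^ n - (q : ℚ) ^ (t + r)) / ((q : ℚ) ^ t - 1) = M := by
    rw [div_eq_iff (sub_ne_zero.2 (one_lt_pow₀ hqQ (by omega)).ne')]
    exact_mod_cast hM
  -- Only the sign of c₂ matters; the second inequality needs just -c₁ ≤ q.
  have hc2 : (0 : ℚ) ≤ c₂ := by
    rw [hc₂]
    split_ifs <;> simp
  have hc1 : (0 : ℚ) ≤ c₁ := by exact_mod_cast hc₁_nonneg
  rw [hMQ]
  constructor <;> linarith

end Bound
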